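/- Let $(M,g_M,J)$ be a Kähler manifold (an almost Hermitian manifold with $\nabla J=0$, $\nabla$ the Levi-Civita connection of $g_M$), let $(N,g_N)$ be a Riemannian manifold, and let $F:M\to N$ be a v-semi-slant submersion. That is, $F$ is a Riemannian submersion (a smooth submersion whose differential preserves the lengths of horizontal vectors) together with a smooth distribution $\mathcal D_1\subset(\ker F_*)^\perp$ with $J(\mathcal D_1)=\mathcal D_1$ and a constant $\theta$ such that, with $\mathcal D_2$ the orthogonal complement of $\mathcal D_1$ in $(\ker F_*)^\perp$, for every $p\in M$ and every nonzero $X\in(\mathcal D_2)_p$ the angle between $JX$ and the space $(\mathcal D_2)_p$ equals $\theta$. Assume that $\theta\neq 0$ unless $\mathcal D_2=0$. Then the complex distribution $\mathcal D_1$ is integrable (that is, $[X,Y]\in\Gamma(\mathcal D_1)$ for all $X,Y\in\Gamma(\mathcal D_1)$) if and only if $$\mathcal A_XY=0\qquad\text{for all }X,Y\in\Gamma(\mathcal D_1),$$ where $\mathcal A_XY=\mathcal H\nabla_{\mathcal HX}\mathcal VY+\mathcal V\nabla_{\mathcal HX}\mathcal HY$, and $\mathcal V,\mathcal H$ denote the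 orthogonal projections of $TM$ onto $\ker F_*$ and $(\ker F_*)^\perp$. -/

import Mathlib

open Bundle Manifold VectorField
open scoped ContDiff InnerProductSpace

noncomputable section

namespace VSemiSlant

section LeviCivita

set_option linter.unusedSectionVars false

variable {E : Type*} [NormedAddCommGroup E] [NormedSpace ℝ E] [FiniteDimensional ℝ E]
  {M : Type*} [TopologicalSpace M] [ChartedSpace E M] [IsManifold 𝓘(ℝ, E) ∞ M]
  [RiemannianBundle (fun x : M => TangentSpace 𝓘(ℝ, E) x)]
  [IsContMDiffRiemannianBundle 𝓘(ℝ, E) ∞ E (fun x : M => TangentSpace 𝓘(ℝ, E) x)]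

instance tangentSpace_finiteDimensional (x : M) :
    FiniteDimensional ℝ (TangentSpace 𝓘(ℝ, E) x) :=
  inferInstanceAs (FiniteDimensional ℝ E)

/-- The Koszul expression
`X⟨Y, Z⟩ + Y⟨X, Z⟩ - Z⟨X, Y⟩ + ⟨[X, Y], Z⟩ - ⟨[X, Z], Y⟩ - ⟨[Y, Z], X⟩` at the point `x`;
for the Levi-Civita connection it equals `2⟨∇_X Y, Z⟩`. -/
def koszul (X Y Z : ∀ x : M, TangentSpace 𝓘(ℝ, E) x) (x : M) : ℝ :=
  mvfderiv 𝓘(ℝ, E) (fun y => ⟪Y y, Z y⟫_ℝ) x (X x)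
  + mvfderiv 𝓘(ℝ, E) (fun y => ⟪X y, Z y⟫_ℝ) x (Y x)
  - mvfderiv 𝓘(ℝ, E) (fun y => ⟪X y, Y y⟫_ℝ) x (Z x)
  + ⟪mlieBracket 𝓘(ℝ, E) X Y x, Z x⟫_ℝ
  - ⟪mlieBracket 𝓘(ℝ, E) X Z x, Y x⟫_ℝ
  - ⟪mlieBracket 𝓘(ℝ, E) Y Z x, X x⟫_ℝ

variable {X X' Y Y' Z Z' : ∀ x : M, TangentSpace 𝓘(ℝ, E) x} {x : M}

lemma mdiff_inner (hX : MDiffAt (T% X) x) (hY : MDiffAt (T% Y) x) :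
    MDiffAt (fun y => ⟪X y, Y y⟫_ℝ) x := by
  have : IsContMDiffRiemannianBundle 𝓘(ℝ, E) 1 E (fun x : M => TangentSpace 𝓘(ℝ, E) x) :=
    inferInstance
  exact MDifferentiableAt.inner_bundle (IB := 𝓘(ℝ, E)) (F := E)
    (E := fun x : M => TangentSpace 𝓘(ℝ, E) x) (b := fun y => y) hX hY

lemma koszul_smul_left {f : M → ℝ} (hf : MDiffAt f x) (hX : MDiffAt (T% X) x)
    (hY : MDiffAt (T% Y) x) (hZ : MDiffAt (T% Z) x) :
    koszul (f • X) Y Z x = f x * koszul X Y Z x := by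
  simp only [koszul, mlieBracket_smul_left hf hX, Pi.smul_apply', inner_smul_left,
    inner_add_left, map_smul, mvfderiv_fun_mul hf (mdiff_inner hX hZ),
    mvfderiv_fun_mul hf (mdiff_inner hX hY), conj_trivial, inner_smul_right]
  simp
  ring

lemma koszul_add_left (hX : MDiffAt (T% X) x) (hX' : MDiffAt (T% X') x)
    (hY : MDiffAt (T% Y) x) (hZ : MDiffAt (T% Z) x) :
    koszul (X + X') Y Z x = koszul X Y Z x + koszul X' Y Z x := by
  simp only [koszul, mlieBracket_add_left hX hX', Pi.add_apply, inner_add_right,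
    inner_add_left, map_add, mvfderiv_fun_add (mdiff_inner hX hZ) (mdiff_inner hX' hZ),
    mvfderiv_fun_add (mdiff_inner hX hY) (mdiff_inner hX' hY)]
  simp
  ring

lemma koszul_smul_right {f : M → ℝ} (hf : MDiffAt f x) (hX : MDiffAt (T% X) x)
    (hY : MDiffAt (T% Y) x) (hZ : MDiffAt (T% Z) x) :
    koszul X Y (f • Z) x = f x * koszul X Y Z x := by
  simp only [koszul, mlieBracket_smul_right hf hZ, Pi.smul_apply', inner_smul_left,
    inner_add_left, map_smul, mvfderiv_fun_mul hf (mdiff_inner hX hZ),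
    mvfderiv_fun_mul hf (mdiff_inner hY hZ), conj_trivial, inner_smul_right]
  simp
  rw [real_inner_comm (Z x) (X x), real_inner_comm (Z x) (Y x)]
  ring

lemma koszul_add_right (hX : MDiffAt (T% X) x) (hY : MDiffAt (T% Y) x)
    (hZ : MDiffAt (T% Z) x) (hZ' : MDiffAt (T% Z') x) :
    koszul X Y (Z + Z') x = koszul X Y Z x + koszul X Y Z' x := by
  simp only [koszul, mlieBracket_add_right hZ hZ', Pi.add_apply, inner_add_right,
    inner_add_left, map_add, mvfderiv_fun_add (mdiff_inner hX hZ) (mdiff_inner hX hZ'),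
    mvfderiv_fun_add (mdiff_inner hY hZ) (mdiff_inner hY hZ')]
  simp
  ring

lemma koszul_smul_mid {f : M → ℝ} (hf : MDiffAt f x) (hX : MDiffAt (T% X) x)
    (hY : MDiffAt (T% Y) x) (hZ : MDiffAt (T% Z) x) :
    koszul X (f • Y) Z x = f x * koszul X Y Z x
      + 2 * (mvfderiv 𝓘(ℝ, E) f x (X x) * ⟪Y x, Z x⟫_ℝ) := by
  simp only [koszul, mlieBracket_smul_left hf hY, mlieBracket_smul_right hf hY, Pi.smul_apply',
    inner_smul_left,
    inner_add_left, map_smul, mvfderiv_fun_mul hf (mdiff_inner hX hY),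
    mvfderiv_fun_mul hf (mdiff_inner hY hZ), conj_trivial, inner_smul_right]
  simp
  rw [real_inner_comm (Y x) (X x)]
  ring

lemma koszul_add_mid (hX : MDiffAt (T% X) x) (hY : MDiffAt (T% Y) x)
    (hY' : MDiffAt (T% Y') x) (hZ : MDiffAt (T% Z) x) :
    koszul X (Y + Y') Z x = koszul X Y Z x + koszul X Y' Z x := by
  simp only [koszul, mlieBracket_add_left hY hY', mlieBracket_add_right hY hY', Pi.add_apply,
    inner_add_right,
    inner_add_left, map_add, mvfderiv_fun_add (mdiff_inner hX hY) (mdiff_inner hX hY'),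
    mvfderiv_fun_add (mdiff_inner hY hZ) (mdiff_inner hY' hZ)]
  simp
  ring

/-- For `Y` differentiable at `x`, the Koszul expression as a bilinear form in the values of
`X` and `Z` at `x`. -/
def koszulForm (Y : ∀ x : M, TangentSpace 𝓘(ℝ, E) x) (x : M) (hY : MDiffAt (T% Y) x) :
    TangentSpace 𝓘(ℝ, E) x →L[ℝ] TangentSpace 𝓘(ℝ, E) x →L[ℝ] ℝ :=
  TensorialAt.mkHom₂ (I := 𝓘(ℝ, E)) (F := E) (F' := E) (fun X Z => koszul X Y Z x) x
    (fun _ hZ => ⟨fun hf hX => koszul_smul_left hf hX hY hZ,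
      fun hX hX' => koszul_add_left hX hX' hY hZ⟩)
    (fun _ hX => ⟨fun hf hZ => koszul_smul_right hf hX hY hZ,
      fun hZ hZ' => koszul_add_right hX hY hZ hZ'⟩)

lemma koszulForm_apply (hX : MDiffAt (T% X) x) (hY : MDiffAt (T% Y) x) (hZ : MDiffAt (T% Z) x) :
    koszulForm Y x hY (X x) (Z x) = koszul X Y Z x :=
  TensorialAt.mkHom₂_apply (I := 𝓘(ℝ, E)) (F := E) (F' := E) _ _ hX hZ

open Classical in
/-- The linear map `v ↦ ∇_v Y` on the tangent space at `x`, obtained from half of the Koszul form by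
expanding in an orthonormal basis. -/
def leviCivitaFun (Y : ∀ x : M, TangentSpace 𝓘(ℝ, E) x) (x : M) :
    TangentSpace 𝓘(ℝ, E) x →L[ℝ] TangentSpace 𝓘(ℝ, E) x :=
  if hY : MDiffAt (T% Y) x then
    ∑ i, ((1 / 2 : ℝ) • (koszulForm Y x hY).flip
      (stdOrthonormalBasis ℝ (TangentSpace 𝓘(ℝ, E) x) i)).smulRight
        (stdOrthonormalBasis ℝ (TangentSpace 𝓘(ℝ, E) x) i)
  else 0

lemma two_mul_inner_leviCivitaFun (hX : MDiffAt (T% X) x) (hY : MDiffAt (T% Y) x)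
    (hZ : MDiffAt (T% Z) x) :
    2 * ⟪leviCivitaFun Y x (X x), Z x⟫_ℝ = koszul X Y Z x := by
  rw [← koszulForm_apply hX hY hZ, leviCivitaFun, dif_pos hY]
  set b := stdOrthonormalBasis ℝ (TangentSpace 𝓘(ℝ, E) x)
  conv_rhs => rw [← b.sum_repr' (Z x)]
  simp [sum_inner, inner_smul_left, Finset.mul_sum]
  refine Finset.sum_congr rfl fun i _ => ?_
  ring

lemma leviCivitaFun_ext {x : M} {A B : TangentSpace 𝓘(ℝ, E) x →L[ℝ] TangentSpace 𝓘(ℝ, E) x}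
    (h : ∀ X Z : ∀ x : M, TangentSpace 𝓘(ℝ, E) x, MDiffAt (T% X) x → MDiffAt (T% Z) x →
      2 * ⟪A (X x), Z x⟫_ℝ = 2 * ⟪B (X x), Z x⟫_ℝ) : A = B := by
  ext v
  refine ext_inner_right ℝ fun w => ?_
  have := h (FiberBundle.extend E v) (FiberBundle.extend E w)
    (FiberBundle.mdifferentiableAt_extend ..) (FiberBundle.mdifferentiableAt_extend ..)
  simpa using this

variable (E M) in
/-- The Levi-Civita connection of the Riemannian metric of `M`, built from the Koszul formula.
As usual for `CovariantDerivative`, `leviCivita E M Y x (X x)` is `(∇_X Y)(x)`. -/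
def leviCivita :
    CovariantDerivative 𝓘(ℝ, E) E (fun x : M => TangentSpace 𝓘(ℝ, E) x) where
  toFun := leviCivitaFun
  isCovariantDerivativeOnUniv :=
    { add := by
        intro Y Y' x hY hY' _
        refine leviCivitaFun_ext fun X Z hX hZ => ?_
        rw [two_mul_inner_leviCivitaFun hX (mdifferentiableAt_add_section hY hY') hZ,
          koszul_add_mid hX hY hY' hZ, ← two_mul_inner_leviCivitaFun hX hY hZ,
          ← two_mul_inner_leviCivitaFun hX hY' hZ]
        simp [inner_add_left]
        ring
      leibniz := by
        intro Y f x hY hf _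
        refine leviCivitaFun_ext fun X Z hX hZ => ?_
        rw [two_mul_inner_leviCivitaFun hX (hf.smul_section hY) hZ,
          koszul_smul_mid hf hX hY hZ, ← two_mul_inner_leviCivitaFun hX hY hZ]
        simp [inner_add_left, inner_smul_left]
        ring }

lemma leviCivita_koszul (hX : MDiffAt (T% X) x) (hY : MDiffAt (T% Y) x)
    (hZ : MDiffAt (T% Z) x) :
    2 * ⟪leviCivita E M Y x (X x), Z x⟫_ℝ = koszul X Y Z x :=
  two_mul_inner_leviCivitaFun hX hY hZ

/-- The Levi-Civita connection is torsion-free. -/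
theorem leviCivita_torsion : (leviCivita E M).torsion = 0 := by
  rw [CovariantDerivative.torsion_eq_zero_iff]
  intro X Y x hX hY
  refine ext_inner_right ℝ fun w => ?_
  have hZ := FiberBundle.mdifferentiableAt_extend 𝓘(ℝ, E) E w
  have h1 := leviCivita_koszul hX hY hZ
  have h2 := leviCivita_koszul hY hX hZ
  simp only [koszul, FiberBundle.extend_apply_self] at h1 h2
  rw [mlieBracket_swap_apply (V := Y) (W := X), inner_neg_left] at h2
  simp only [real_inner_comm (X _) (Y _)] at h1 h2
  rw [inner_sub_left]
  linarith

/-- The Levi-Civita connection is metric: `X⟨Y, Z⟩ = ⟨∇_X Y, Z⟩ + ⟨Y, ∇_X Z⟩`. -/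
theorem leviCivita_metric (hX : MDiffAt (T% X) x) (hY : MDiffAt (T% Y) x)
    (hZ : MDiffAt (T% Z) x) :
    mvfderiv 𝓘(ℝ, E) (fun y => ⟪Y y, Z y⟫_ℝ) x (X x) =
      ⟪leviCivita E M Y x (X x), Z x⟫_ℝ + ⟪Y x, leviCivita E M Z x (X x)⟫_ℝ := by
  have h1 := leviCivita_koszul hX hY hZ
  have h2 := leviCivita_koszul hX hZ hY
  simp only [koszul] at h1 h2
  rw [mlieBracket_swap_apply (V := Z) (W := Y), inner_neg_left] at h2
  simp only [real_inner_comm (Y _) (Z _)] at h1 h2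
  rw [real_inner_comm _ (Y x)]
  linarith

end LeviCivita
section Kahler

variable {E : Type*} [NormedAddCommGroup E] [NormedSpace ℝ E] [FiniteDimensional ℝ E]
  {M : Type*} [TopologicalSpace M] [ChartedSpace E M] [IsManifold 𝓘(ℝ, E) ∞ M]
  [RiemannianBundle (fun x : M => TangentSpace 𝓘(ℝ, E) x)]

/-- `J` is an almost complex structure on `M`, smooth and orthogonal for the Riemannian metric:
`(M, g, J)` is an almost Hermitian manifold. -/
structure IsAlmostHermitian
    (J : ∀ x : M, TangentSpace 𝓘(ℝ, E) x →L[ℝ] TangentSpace 𝓘(ℝ, E) x) : Prop where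
  smooth : ContMDiff 𝓘(ℝ, E) (𝓘(ℝ, E).prod 𝓘(ℝ, E →L[ℝ] E)) ∞
    (fun x => TotalSpace.mk' (E →L[ℝ] E)
      (E := fun x : M => TangentSpace 𝓘(ℝ, E) x →L[ℝ] TangentSpace 𝓘(ℝ, E) x) x (J x))
  sq : ∀ (x : M) (v : TangentSpace 𝓘(ℝ, E) x), J x (J x v) = -v
  inner_map : ∀ (x : M) (v w : TangentSpace 𝓘(ℝ, E) x), ⟪J x v, J x w⟫_ℝ = ⟪v, w⟫_ℝ

/-- `(M, g, J)` is a Kähler manifold: almost Hermitian with `∇J = 0`, that is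
`∇_X (JY) = J ∇_X Y` for all smooth vector fields `X`, `Y`. -/
structure IsKahler
    [IsContMDiffRiemannianBundle 𝓘(ℝ, E) ∞ E (fun x : M => TangentSpace 𝓘(ℝ, E) x)]
    (J : ∀ x : M, TangentSpace 𝓘(ℝ, E) x →L[ℝ] TangentSpace 𝓘(ℝ, E) x) : Prop
    extends IsAlmostHermitian J where
  parallel : ∀ X Y : ∀ x : M, TangentSpace 𝓘(ℝ, E) x, CMDiff ∞ (T% X) → CMDiff ∞ (T% Y) →
    ∀ x : M, leviCivita E M (fun y => J y (Y y)) x (X x) = J x (leviCivita E M Y x (X x))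

end Kahler

section Distribution

variable {E : Type*} [NormedAddCommGroup E] [NormedSpace ℝ E]
  {M : Type*} [TopologicalSpace M] [ChartedSpace E M] [IsManifold 𝓘(ℝ, E) ∞ M]

/-- A smooth distribution (subbundle of `TM`): near every point it has a smooth local frame. -/
def IsSmoothDistribution (D : ∀ x : M, Submodule ℝ (TangentSpace 𝓘(ℝ, E) x)) : Prop :=
  ∀ x₀ : M, ∃ U : Set M, IsOpen U ∧ x₀ ∈ U ∧
    ∃ (k : ℕ) (e : Fin k → ∀ x : M, TangentSpace 𝓘(ℝ, E) x),
      (∀ i, CMDiff[U] ∞ (T% (e i))) ∧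
      ∀ x ∈ U, LinearIndependent ℝ (fun i => e i x) ∧
        Submodule.span ℝ (Set.range fun i => e i x) = D x

/-- `X ∈ Γ(D)`: `X` is a smooth vector field on `M` with values in `D`. -/
def IsSection (D : ∀ x : M, Submodule ℝ (TangentSpace 𝓘(ℝ, E) x))
    (X : ∀ x : M, TangentSpace 𝓘(ℝ, E) x) : Prop :=
  CMDiff ∞ (T% X) ∧ ∀ x, X x ∈ D x

/-- The distribution `D` is integrable: `[X, Y] ∈ Γ(D)` for all `X, Y ∈ Γ(D)`. -/
def IsIntegrableDistribution (D : ∀ x : M, Submodule ℝ (TangentSpace 𝓘(ℝ, E) x)) : Prop :=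
  ∀ X Y : ∀ x : M, TangentSpace 𝓘(ℝ, E) x, IsSection D X → IsSection D Y →
    IsSection D (mlieBracket 𝓘(ℝ, E) X Y)

end Distribution

/-- The angle in `[0, π/2]` between a (nonzero) vector `v` and a subspace `W`: its cosine is the
norm of the orthogonal projection of `v` to `W` divided by the norm of `v`. -/
def angleWithSubspace {V : Type*} [NormedAddCommGroup V] [InnerProductSpace ℝ V]
    [FiniteDimensional ℝ V] (v : V) (W : Submodule ℝ V) : ℝ :=
  Real.arccos (‖W.starProjection v‖ / ‖v‖)

section Submersion

variable {E : Type*} [NormedAddCommGroup E] [NormedSpace ℝ E] [FiniteDimensional ℝ E]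
  {M : Type*} [TopologicalSpace M] [ChartedSpace E M] [IsManifold 𝓘(ℝ, E) ∞ M]
  [RiemannianBundle (fun x : M => TangentSpace 𝓘(ℝ, E) x)]
  {E' : Type*} [NormedAddCommGroup E'] [NormedSpace ℝ E'] [FiniteDimensional ℝ E']
  {N : Type*} [TopologicalSpace N] [ChartedSpace E' N] [IsManifold 𝓘(ℝ, E') ∞ N]

/-- The vertical space `ker (F_*)_x`. -/
def vertical (F : M → N) (x : M) : Submodule ℝ (TangentSpace 𝓘(ℝ, E) x) :=
  (mfderiv 𝓘(ℝ, E) 𝓘(ℝ, E') F x).ker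

/-- The horizontal space `(ker (F_*)_x)ᗮ`. -/
def horizontal (F : M → N) (x : M) : Submodule ℝ (TangentSpace 𝓘(ℝ, E) x) :=
  (vertical (E := E) (E' := E') F x)ᗮ

/-- The vertical part of a vector field. -/
def vPart (F : M → N) (X : ∀ x : M, TangentSpace 𝓘(ℝ, E) x) (x : M) : TangentSpace 𝓘(ℝ, E) x :=
  (vertical (E := E) (E' := E') F x).starProjection (X x)

/-- The horizontal part of a vector field. -/
def hPart (F : M → N) (X : ∀ x : M, TangentSpace 𝓘(ℝ, E) x) (x : M) : TangentSpace 𝓘(ℝ, E) x :=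
  (horizontal (E := E) (E' := E') F x).starProjection (X x)

/-- `F` is a Riemannian submersion: smooth, with surjective differentials that preserve the length
of horizontal vectors. -/
structure IsRiemannianSubmersion [RiemannianBundle (fun y : N => TangentSpace 𝓘(ℝ, E') y)]
    (F : M → N) : Prop where
  smooth : ContMDiff 𝓘(ℝ, E) 𝓘(ℝ, E') ∞ F
  surjective : ∀ x : M, Function.Surjective (mfderiv 𝓘(ℝ, E) 𝓘(ℝ, E') F x)
  norm_map : ∀ (x : M), ∀ v ∈ horizontal (E := E) (E' := E') F x,
    ‖mfderiv 𝓘(ℝ, E) 𝓘(ℝ, E') F x v‖ = ‖v‖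

/-- O'Neill's tensor `A_X Y = H ∇_{HX} (VY) + V ∇_{HX} (HY)`. -/
def oneillA [IsContMDiffRiemannianBundle 𝓘(ℝ, E) ∞ E (fun x : M => TangentSpace 𝓘(ℝ, E) x)]
    (F : M → N) (X Y : ∀ x : M, TangentSpace 𝓘(ℝ, E) x) : ∀ x : M, TangentSpace 𝓘(ℝ, E) x :=
  hPart (E' := E') F (fun x => leviCivita E M (vPart (E' := E') F Y) x (hPart (E' := E') F X x))
  + vPart (E' := E') F (fun x => leviCivita E M (hPart (E' := E') F Y) x (hPart (E' := E') F X x))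

/-- The slant distribution `D₂`: the orthogonal complement of `D₁` in `(ker F_*)ᗮ`. -/
def slantDistribution (F : M → N) (D₁ : ∀ x : M, Submodule ℝ (TangentSpace 𝓘(ℝ, E) x)) (x : M) :
    Submodule ℝ (TangentSpace 𝓘(ℝ, E) x) :=
  (D₁ x)ᗮ ⊓ horizontal (E := E) (E' := E') F x

/-- `F` is a v-semi-slant submersion with complex distribution `D₁` and v-semi-slant angle `θ`.
The splitting `(ker F_*)ᗮ = D₁ ⊕ D₂` holds by definition of `D₂`. -/
structure IsVSemiSlantSubmersion [RiemannianBundle (fun y : N => TangentSpace 𝓘(ℝ, E') y)]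
    (F : M → N) (J : ∀ x : M, TangentSpace 𝓘(ℝ, E) x →L[ℝ] TangentSpace 𝓘(ℝ, E) x)
    (D₁ : ∀ x : M, Submodule ℝ (TangentSpace 𝓘(ℝ, E) x)) (θ : ℝ) : Prop
    extends IsRiemannianSubmersion (E := E) (E' := E') F where
  smooth_distribution : IsSmoothDistribution D₁
  le_horizontal : ∀ x : M, D₁ x ≤ horizontal (E := E) (E' := E') F x
  map_eq : ∀ x : M, (D₁ x).map (J x : TangentSpace 𝓘(ℝ, E) x →ₗ[ℝ] TangentSpace 𝓘(ℝ, E) x) = D₁ x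
  angle_eq : ∀ (x : M), ∀ X ∈ slantDistribution (E' := E') F D₁ x, X ≠ 0 →
    angleWithSubspace (J x X) (slantDistribution (E' := E') F D₁ x) = θ

end Submersion

end VSemiSlant

end

open VSemiSlant

open VSemiSlant

/-! Sections of `D₁` are horizontal, so for them O'Neill's tensor reduces to the vertical part of
`∇_X Y` (`oneillA_eq_zero_iff`). A Riemannian submersion is isometric on horizontal vectors and
kills vertical ones, so the Lie derivative of the metric along a vertical field vanishes on
horizontal pairs (`mvfderiv_inner_of_vertical`). By the Koszul formula the vertical part of `∇_X Y`
is then alternating in `X`, `Y` (`inner_leviCivita_add_swap`). As the connection is torsion-free,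
that part is half the vertical part of `[X, Y]`. If `D₁` is integrable, `[X, Y]` is horizontal and
`A_X Y = 0`.

Conversely, let `A` vanish on `D₁` and put `u = ∇_X Y`. Then `u` is horizontal, and so is `J u = ∇_X
(JY)`, since `J` is parallel and `JY` is again a section of `D₁`. The `D₂`-component `b` of `u` then
has `J b` in `D₂`, so a nonzero `b` would make the slant angle zero; hence `u ∈ D₁`
(`mem_of_mem_horizontal`). Finally `[X, Y] = ∇_X Y - ∇_Y X` lies in `D₁`. -/

open Set Filter Topology

/-! ### Derivatives and Lie brackets read in a chart. -/

section ChartDerivative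

set_option linter.unusedSectionVars false

variable {E : Type*} [NormedAddCommGroup E] [NormedSpace ℝ E]
  {M : Type*} [TopologicalSpace M] [ChartedSpace E M] [IsManifold 𝓘(ℝ, E) ∞ M]
  {G : Type*} [NormedAddCommGroup G] [NormedSpace ℝ G]

/-- The derivative of `f` computed in the chart at `x`. -/
lemma mvfderiv_eq_fderiv_extChartAt {f : M → G} {x y : M}
    (hy : y ∈ (extChartAt 𝓘(ℝ, E) x).source) (hf : MDifferentiableAt 𝓘(ℝ, E) 𝓘(ℝ, G) f y)
    (v : TangentSpace 𝓘(ℝ, E) y) :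
    mvfderiv 𝓘(ℝ, E) f y v =
      fderiv ℝ (f ∘ (extChartAt 𝓘(ℝ, E) x).symm) (extChartAt 𝓘(ℝ, E) x y)
        (mfderiv 𝓘(ℝ, E) 𝓘(ℝ, E) (extChartAt 𝓘(ℝ, E) x) y v) := by
  set φ := extChartAt 𝓘(ℝ, E) x
  have hφ : MDifferentiableAt 𝓘(ℝ, E) 𝓘(ℝ, E) φ y :=
    mdifferentiableAt_extChartAt (by simpa [φ] using hy)
  have hs : MDifferentiableAt 𝓘(ℝ, E) 𝓘(ℝ, E) φ.symm (φ y) := by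
    have := mdifferentiableWithinAt_extChartAt_symm (I := 𝓘(ℝ, E)) (φ.map_source hy)
    rwa [modelWithCornersSelf_coe, range_id, mdifferentiableWithinAt_univ] at this
  have hf' : MDifferentiableAt 𝓘(ℝ, E) 𝓘(ℝ, G) (f ∘ φ.symm) (φ y) :=
    MDifferentiableAt.comp _ (by rwa [φ.left_inv hy]) hs
  have heq : f =ᶠ[𝓝 y] (f ∘ φ.symm) ∘ φ := by
    filter_upwards [(isOpen_extChartAt_source x).mem_nhds hy] with z hz
    rw [Function.comp_apply, Function.comp_apply, φ.left_inv hz]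
  simp only [mvfderiv]
  rw [heq.mfderiv_eq, mfderiv_comp y hf' hφ, mfderiv_eq_fderiv]
  rfl

lemma contDiffAt_comp_extChartAt_symm {f : M → G} {x : M}
    (hf : ContMDiffAt 𝓘(ℝ, E) 𝓘(ℝ, G) ∞ f x) :
    ContDiffAt ℝ ∞ (f ∘ (extChartAt 𝓘(ℝ, E) x).symm) (extChartAt 𝓘(ℝ, E) x x) := by
  have hs := contMDiffWithinAt_extChartAt_symm_range (I := 𝓘(ℝ, E)) (n := ∞) x
    (mem_extChartAt_target x)
  simp only [modelWithCornersSelf_coe, range_id, contMDiffWithinAt_univ] at hs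
  exact (ContMDiffAt.comp _ (by rwa [extChartAt_to_inv x]) hs).contDiffAt

lemma eventually_mdifferentiableAt {f : M → G} {x : M}
    (hf : ContMDiffAt 𝓘(ℝ, E) 𝓘(ℝ, G) ∞ f x) :
    ∀ᶠ y in 𝓝 x, MDifferentiableAt 𝓘(ℝ, E) 𝓘(ℝ, G) f y := by
  -- Smoothness of finite order at a point spreads to a neighbourhood; order `∞` need not, so it is
  -- lowered to `1` first.
  have h1 : ContMDiffAt 𝓘(ℝ, E) 𝓘(ℝ, G) 1 f x := hf.of_le (by simp)
  filter_upwards [(contMDiffAt_iff_contMDiffAt_nhds (by simp)).1 h1] with y hy using hy.mdifferentiableAt one_ne_zero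

lemma mvfderiv_fun_sum {ι : Type*} (s : Finset ι) {f : ι → M → ℝ} {x : M}
    (hf : ∀ i ∈ s, MDiffAt (f i) x) :
    MDiffAt (fun y => ∑ i ∈ s, f i y) x ∧
    mvfderiv 𝓘(ℝ, E) (fun y => ∑ i ∈ s, f i y) x = ∑ i ∈ s, mvfderiv 𝓘(ℝ, E) (f i) x := by
  classical
  induction s using Finset.induction_on with
  | empty => simpa using ⟨mdifferentiableAt_const, mvfderiv_const 0⟩
  | insert a s ha ih =>
    obtain ⟨h1, h2⟩ := ih fun i hi => hf i (Finset.mem_insert_of_mem hi)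
    have h3 := hf a (Finset.mem_insert_self a s)
    simp only [Finset.sum_insert ha]
    exact ⟨h3.add h1, by rw [mvfderiv_fun_add h3 h1, h2]⟩

variable [CompleteSpace E]

/-- A bracket of vector fields acts on functions as the commutator. -/
lemma mvfderiv_mlieBracket {f : M → G} {x : M} (hf : ContMDiffAt 𝓘(ℝ, E) 𝓘(ℝ, G) ∞ f x)
    {V W : ∀ x : M, TangentSpace 𝓘(ℝ, E) x} (hV : MDiffAt (T% V) x) (hW : MDiffAt (T% W) x) :
    MDifferentiableAt 𝓘(ℝ, E) 𝓘(ℝ, G) (fun y => mvfderiv 𝓘(ℝ, E) f y (W y)) x ∧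
    mvfderiv 𝓘(ℝ, E) f x (mlieBracket 𝓘(ℝ, E) V W x) =
      mvfderiv 𝓘(ℝ, E) (fun y => mvfderiv 𝓘(ℝ, E) f y (W y)) x (V x) -
      mvfderiv 𝓘(ℝ, E) (fun y => mvfderiv 𝓘(ℝ, E) f y (V y)) x (W x) := by
  set φ := extChartAt 𝓘(ℝ, E) x with hφdef
  set g : E → G := f ∘ φ.symm with hg
  have hx : x ∈ φ.source := mem_extChartAt_source x
  have hgsm : ContDiffAt ℝ ∞ g (φ x) := contDiffAt_comp_extChartAt_symm hf
  have hdg : DifferentiableAt ℝ (fderiv ℝ g) (φ x) :=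
    (hgsm.fderiv_right (m := 1) (by norm_cast)).differentiableAt one_ne_zero
  have hφx : MDifferentiableAt 𝓘(ℝ, E) 𝓘(ℝ, E) φ x :=
    mdifferentiableAt_extChartAt (by simp)
  -- `c U` is the coordinate expression of `U`, a map between open parts of the vector space `E`
  -- near `φ x`.
  let c : (∀ x : M, TangentSpace 𝓘(ℝ, E) x) → E → E := fun U =>
    mpullbackWithin 𝓘(ℝ, E) 𝓘(ℝ, E) φ.symm U univ
  have hc : ∀ U : ∀ x : M, TangentSpace 𝓘(ℝ, E) x, ∀ y ∈ φ.source,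
      c U (φ y) = mfderiv 𝓘(ℝ, E) 𝓘(ℝ, E) φ y (U y) := by
    intro U y hy
    have h1 := isInvertible_mfderivWithin_extChartAt_symm (I := 𝓘(ℝ, E)) (φ.map_source hy)
    have h2 := mfderivWithin_extChartAt_symm_comp_mfderiv_extChartAt (I := 𝓘(ℝ, E))
      (φ.map_source hy)
    simp only [modelWithCornersSelf_coe, range_id] at h1 h2
    have h3 : c U (φ y) = mfderiv 𝓘(ℝ, E) 𝓘(ℝ, E) φ (φ.symm (φ y)) (U (φ.symm (φ y))) :=
      h1.inverse_apply_eq.2 (DFunLike.congr_fun h2 (U (φ.symm (φ y)))).symm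
    rwa [φ.left_inv hy] at h3
  have hcd : ∀ U : ∀ x : M, TangentSpace 𝓘(ℝ, E) x, MDiffAt (T% U) x →
      DifferentiableAt ℝ (c U) (φ x) := by
    intro U hU
    have := (mdifferentiableWithinAt_univ.2
      hU).differentiableWithinAt_mpullbackWithin_vectorField
    rw [modelWithCornersSelf_coe, range_id, preimage_univ, univ_inter] at this
    exact differentiableWithinAt_univ.1 this
  have hrep : ∀ U : ∀ x : M, TangentSpace 𝓘(ℝ, E) x,
      (fun y => mvfderiv 𝓘(ℝ, E) f y (U y)) =ᶠ[𝓝 x] (fun z => fderiv ℝ g z (c U z)) ∘ φ := by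
    intro U
    filter_upwards [(isOpen_extChartAt_source x).mem_nhds hx, eventually_mdifferentiableAt hf]
      with y hy hfy
    rw [mvfderiv_eq_fderiv_extChartAt hy hfy, Function.comp_apply, hc U y hy]
  have hdiff : ∀ U : ∀ x : M, TangentSpace 𝓘(ℝ, E) x, MDiffAt (T% U) x →
      DifferentiableAt ℝ (fun z => fderiv ℝ g z (c U z)) (φ x) :=
    fun U hU => hdg.clm_apply (hcd U hU)
  -- The product rule for `Dg(z)(c U z)`. In the commutator the second-derivative terms cancel by
  -- symmetry, and the first terms form the bracket of the coordinate fields.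
  have hder : ∀ U U' : ∀ x : M, TangentSpace 𝓘(ℝ, E) x, MDiffAt (T% U) x →
      mvfderiv 𝓘(ℝ, E) (fun y => mvfderiv 𝓘(ℝ, E) f y (U y)) x (U' x) =
        fderiv ℝ g (φ x) (fderiv ℝ (c U) (φ x) (c U' (φ x))) +
        fderiv ℝ (fderiv ℝ g) (φ x) (c U' (φ x)) (c U (φ x)) := by
    intro U U' hU
    simp only [mvfderiv] at hrep ⊢
    rw [(hrep U).mfderiv_eq, mfderiv_comp x (hdiff U hU).mdifferentiableAt hφx, mfderiv_eq_fderiv]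
    rw [fderiv_clm_apply hdg (hcd U hU), hc U' x hx]
    rfl
  refine ⟨((hdiff W hW).mdifferentiableAt.comp x hφx).congr_of_eventuallyEq (hrep W), ?_⟩
  rw [hder W V hW, hder V W hV, mvfderiv_eq_fderiv_extChartAt hx
    (hf.mdifferentiableAt (by simp))]
  obtain ⟨b, hb⟩ : ∃ b : E, b = lieBracket ℝ (c V) (c W) (φ x) := ⟨_, rfl⟩
  -- The bracket on `M` is by definition the pullback under the chart of the coordinate bracket, so
  -- `dφ` carries one to the other.
  have hbr : mfderiv 𝓘(ℝ, E) 𝓘(ℝ, E) φ x (mlieBracket 𝓘(ℝ, E) V W x) =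
b := by
    have h1 := isInvertible_mfderiv_extChartAt (I := 𝓘(ℝ, E)) hx
    have h2 : mlieBracket 𝓘(ℝ, E) V W x = (mfderiv 𝓘(ℝ, E) 𝓘(ℝ, E) φ x).inverse b := by
      rw [mlieBracket, mlieBracketWithin_apply]
      simp only [modelWithCornersSelf_coe, range_id, preimage_univ, univ_inter]
      rw [hb, ← lieBracketWithin_univ]
    exact (h1.inverse_apply_eq.1 h2.symm).symm
  rw [hbr, hb, lieBracket_eq, map_sub]
  have hsym : IsSymmSndFDerivAt ℝ g (φ x) := hgsm.isSymmSndFDerivAt (by simp; norm_cast)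
  rw [hsym.eq (c W (φ x)) (c V (φ x))]
  abel

end ChartDerivative

/-! ### Extending a kernel vector to a field of kernel vectors. -/

section VerticalExtension

set_option linter.unusedSectionVars false

variable {E : Type*} [NormedAddCommGroup E] [NormedSpace ℝ E] [FiniteDimensional ℝ E]
  {M : Type*} [TopologicalSpace M] [ChartedSpace E M] [IsManifold 𝓘(ℝ, E) ∞ M]
  {G : Type*} [NormedAddCommGroup G] [NormedSpace ℝ G] [FiniteDimensional ℝ G]

/-- If a smooth family of linear maps is surjective at `z₀`, a vector in the kernel at `z₀` extends
to a differentiable family of vectors in the kernels. -/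
lemma exists_differentiableAt_mem_ker {A : E → E →L[ℝ] G} {z₀ : E}
    (hA : DifferentiableAt ℝ A z₀) (hsurj : Function.Surjective (A z₀)) {w : E}
    (hw : A z₀ w = 0) :
    ∃ c : E → E, DifferentiableAt ℝ c z₀ ∧ c z₀ = w ∧ ∀ᶠ z in 𝓝 z₀, A z (c z) = 0 := by
  have : CompleteSpace G := FiniteDimensional.complete ℝ G
  obtain ⟨R₀, hR₀⟩ := (A z₀ : E →ₗ[ℝ] G).exists_rightInverse_of_surjective
    (LinearMap.range_eq_top.2 hsurj)
  let R : G →L[ℝ] E := R₀.toContinuousLinearMap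
  have hR : A z₀ ∘L R = 1 := by
    ext a
    exact LinearMap.congr_fun hR₀ a
  have hAR : DifferentiableAt ℝ (fun z => A z ∘L R) z₀ := hA.clm_comp (differentiableAt_const R)
  have hunit : IsUnit (A z₀ ∘L R) := hR ▸ isUnit_one
  have hinv : DifferentiableAt ℝ (fun z => Ring.inverse (A z ∘L R)) z₀ := 
    hAR.inverse hunit
  -- The projection of `w` to `ker (A z)` along the range of `R`. The correction vanishes at `z₀`
  -- because `A z₀ w = 0`; near `z₀` the map `A z ∘L R` stays invertible, units being open.
  refine ⟨fun z => w - R (Ring.inverse (A z ∘L R) (A z w)), ?_, by simp [hw], ?_⟩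
  · fun_prop
  · have : ∀ᶠ z in 𝓝 z₀, IsUnit (A z ∘L R) := hAR.continuousAt.eventually_mem
      (Units.isOpen.mem_nhds hunit)
    filter_upwards [this] with z hz
    have h1 := DFunLike.congr_fun (Ring.mul_inverse_cancel _ hz) (A z w)
    change A z (R (Ring.inverse (A z ∘L R) (A z w))) = A z w at h1
    rw [map_sub, h1, sub_self]

/-- Near a point where the derivative of `f` is surjective, vectors in its kernel extend to
vector fields tangent to the fibres of `f`. -/
lemma exists_extension_mvfderiv_eq_zero {f : M → G} {x : M}
    (hf : ContMDiffAt 𝓘(ℝ, E) 𝓘(ℝ, G) ∞ f x)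
    (hsurj : Function.Surjective (mvfderiv 𝓘(ℝ, E) f x)) {w : TangentSpace 𝓘(ℝ, E) x}
    (hw : mvfderiv 𝓘(ℝ, E) f x w = 0) :
    ∃ V : ∀ y : M, TangentSpace 𝓘(ℝ, E) y, MDiffAt (T% V) x ∧ V x = w ∧
      ∀ᶠ y in 𝓝 x, mvfderiv 𝓘(ℝ, E) f y (V y) = 0 := by
  set φ := extChartAt 𝓘(ℝ, E) x with hφdef
  set g : E → G := f ∘ φ.symm with hg
  set e := trivializationAt E (TangentSpace 𝓘(ℝ, E)) x
  have hx : x ∈ φ.source := mem_extChartAt_source x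
  have hφx : MDifferentiableAt 𝓘(ℝ, E) 𝓘(ℝ, E) φ x :=
    mdifferentiableAt_extChartAt (by simp)
  have hdg : DifferentiableAt ℝ (fderiv ℝ g) (φ x) :=
    ((contDiffAt_comp_extChartAt_symm hf).fderiv_right (m := 1)
      (by norm_cast)).differentiableAt one_ne_zero
  -- Over the chart domain the trivialization at `x` is `dφ`, so the kernels of `df` become those of
  -- the family `fderiv ℝ g` on `E`.
  have hrep : ∀ y ∈ φ.source, MDifferentiableAt 𝓘(ℝ, E) 𝓘(ℝ, G) f y →
      ∀ v : TangentSpace 𝓘(ℝ, E) y,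
        mvfderiv 𝓘(ℝ, E) f y v = fderiv ℝ g (φ y) (e.continuousLinearMapAt ℝ y v) := by
    intro y hy hfy v
    rw [mvfderiv_eq_fderiv_extChartAt hy hfy,
      TangentBundle.continuousLinearMapAt_trivializationAt (by simpa [hφdef] using hy)]
    rfl
  have hfx := hf.mdifferentiableAt (by simp)
  have hxe : x ∈ e.baseSet := mem_baseSet_trivializationAt E (TangentSpace 𝓘(ℝ, E)) x
  have hs : Function.Surjective (fderiv ℝ g (φ x)) := fun a => by
    obtain ⟨v, hv⟩ := hsurj a
    exact ⟨_, (hrep x hx hfx v).symm.trans hv⟩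
  obtain ⟨c, hc, hcx, hc0⟩ := exists_differentiableAt_mem_ker hdg hs
    ((hrep x hx hfx w).symm.trans hw)
  refine ⟨fun y => e.symmL ℝ y (c (φ y)), ?_, ?_, ?_⟩
  · rw [e.mdifferentiableAt_section_iff 𝓘(ℝ, E) _ hxe]
    refine (hc.mdifferentiableAt.comp x hφx).congr_of_eventuallyEq ?_
    filter_upwards [e.open_baseSet.mem_nhds hxe] with y hy
    rw [Function.comp_apply]
    have := e.continuousLinearMapAt_symmL (R := ℝ) hy (c (φ y))
    rwa [e.continuousLinearMapAt_apply (R := ℝ), e.linearMapAt_apply, if_pos hy] at this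
  · simp only [hcx]
    exact e.symmL_continuousLinearMapAt hxe w
  · filter_upwards [(continuousAt_extChartAt x).eventually hc0,
      (isOpen_extChartAt_source x).mem_nhds hx, eventually_mdifferentiableAt hf,
      e.open_baseSet.mem_nhds hxe] with y hy hyφ hfy hye
    rw [hrep y hyφ hfy, e.continuousLinearMapAt_symmL hye]
    exact hy

end VerticalExtension

/-! ### Riemannian submersions and O'Neill's lemma. -/

section RiemannianSubmersion

set_option linter.unusedSectionVars false

variable {E : Type*} [NormedAddCommGroup E] [NormedSpace ℝ E] [FiniteDimensional ℝ E]
  {M : Type*} [TopologicalSpace M] [ChartedSpace E M] [IsManifold 𝓘(ℝ, E) ∞ M]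
  [RiemannianBundle (fun x : M => TangentSpace 𝓘(ℝ, E) x)]
  {E' : Type*} [NormedAddCommGroup E'] [NormedSpace ℝ E'] [FiniteDimensional ℝ E']
  {N : Type*} [TopologicalSpace N] [ChartedSpace E' N] [IsManifold 𝓘(ℝ, E') ∞ N]
  [RiemannianBundle (fun y : N => TangentSpace 𝓘(ℝ, E') y)]

/-- Polarization of the norm condition. The vertical part of `w` drops out on both sides, so only
one of the two vectors has to be horizontal. -/
lemma inner_mfderiv_of_mem_horizontal {F : M → N}
    (hF : IsRiemannianSubmersion (E := E) (E' := E') F) {x : M} {v w : TangentSpace 𝓘(ℝ, E) x}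
    (hv : v ∈ horizontal (E := E) (E' := E') F x) :
    ⟪mfderiv 𝓘(ℝ, E) 𝓘(ℝ, E') F x v, mfderiv 𝓘(ℝ, E) 𝓘(ℝ, E') F x w⟫_ℝ = ⟪v, w⟫_ℝ := by
  obtain ⟨a, ha, b, hb, rfl⟩ :=
    (vertical (E := E) (E' := E') F x).exists_add_mem_mem_orthogonal w
  have ha' : mfderiv 𝓘(ℝ, E) 𝓘(ℝ, E') F x a = 0 := ha
  rw [map_add, ha', zero_add, inner_add_right, Submodule.inner_left_of_mem_orthogonal ha hv,
    zero_add]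
  have h1 := hF.norm_map x v hv
  have h2 := hF.norm_map x b hb
  have h3 := hF.norm_map x (v + b) (add_mem hv hb)
  rw [map_add] at h3
  have h4 := norm_add_sq_real v b
  have h5 := norm_add_sq_real (mfderiv 𝓘(ℝ, E) 𝓘(ℝ, E') F x v) (mfderiv 𝓘(ℝ, E) 𝓘(ℝ, E') F x b)
  rw [h1, h2, h3] at h5
  linarith

variable [IsContMDiffRiemannianBundle 𝓘(ℝ, E') ∞ E' (fun y : N => TangentSpace 𝓘(ℝ, E') y)]

/-- Local coordinates `f i` and the coefficients `h i j` of the metric in them. -/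
lemma exists_coordinates (q : N) :
    ∃ (n : ℕ) (f : Fin n → N → ℝ) (h : Fin n → Fin n → N → ℝ),
      (∀ i, ContMDiffAt 𝓘(ℝ, E') 𝓘(ℝ, ℝ) ∞ (f i) q) ∧ (∀ i j, MDiffAt (h i j) q) ∧
      ∀ᶠ z in 𝓝 q, ∀ a b : TangentSpace 𝓘(ℝ, E') z,
        ⟪a, b⟫_ℝ = ∑ i, ∑ j, mvfderiv 𝓘(ℝ, E') (f i) z a * mvfderiv 𝓘(ℝ, E') (f j) z b * h i j z := by
  let b := Module.finBasis ℝ E'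
  let ℓ : Fin (Module.finrank ℝ E') → E' →L[ℝ] ℝ := fun i => (b.coord i).toContinuousLinearMap
  set T := trivializationAt E' (TangentSpace 𝓘(ℝ, E')) q with hT
  set φ := extChartAt 𝓘(ℝ, E') q with hφ
  let e : Fin (Module.finrank ℝ E') → ∀ z : N, TangentSpace 𝓘(ℝ, E') z := fun i z =>
    T.symmL ℝ z (b i)
  have hqT : q ∈ T.baseSet := mem_baseSet_trivializationAt E' (TangentSpace 𝓘(ℝ, E')) q
  have hq : q ∈ φ.source := mem_extChartAt_source q
  have he : ∀ i, MDiffAt (T% (e i)) q := by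
    intro i
    rw [T.mdifferentiableAt_section_iff 𝓘(ℝ, E') _ hqT]
    refine (mdifferentiableAt_const (c := b i)).congr_of_eventuallyEq ?_
    filter_upwards [T.open_baseSet.mem_nhds hqT] with z hz
    have := T.continuousLinearMapAt_symmL (R := ℝ) hz (b i)
    rwa [T.continuousLinearMapAt_apply (R := ℝ), T.linearMapAt_apply, if_pos hz] at this
  -- The `f i` are the chart coordinates and `h` is the Gram matrix of the coordinate frame `e`, to
  -- which the differentials of the `f i` are dual.
  refine ⟨_, fun i => ℓ i ∘ φ, fun i j z => ⟪e i z, e j z⟫_ℝ, fun i => ?_,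
    fun i j => mdiff_inner (he i) (he j), ?_⟩
  · exact (ℓ i).contMDiff.contMDiffAt.comp q contMDiffAt_extChartAt
  · filter_upwards [T.open_baseSet.mem_nhds hqT, (isOpen_extChartAt_source q).mem_nhds hq]
      with z hz hzφ v w
    have hφz : MDifferentiableAt 𝓘(ℝ, E') 𝓘(ℝ, E') φ z :=
      mdifferentiableAt_extChartAt (by simpa [hφ] using hzφ)
    have hd : ∀ i, ∀ v : TangentSpace 𝓘(ℝ, E') z,
        mvfderiv 𝓘(ℝ, E') (ℓ i ∘ φ) z v = b.repr (T.continuousLinearMapAt ℝ z v) i := by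
      intro i v
      rw [TangentBundle.continuousLinearMapAt_trivializationAt (by simpa [hφ] using hzφ)]
      simp only [mvfderiv]
      rw [mfderiv_comp z (ℓ i).mdifferentiableAt hφz, ContinuousLinearMap.mfderiv_eq]
      rfl
    have hexp : ∀ v : TangentSpace 𝓘(ℝ, E') z,
        v = ∑ i, b.repr (T.continuousLinearMapAt ℝ z v) i • e i z := by
      intro v
      conv_lhs => rw [← T.symmL_continuousLinearMapAt (R := ℝ) hz v,
        ← b.sum_repr (T.continuousLinearMapAt ℝ z v)]
      simp only [map_sum, map_smul, e]
    simp only [hd]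
    conv_lhs => rw [hexp v, hexp w]
    rw [sum_inner]
    refine Finset.sum_congr rfl fun i _ => ?_
    rw [inner_smul_left, inner_sum, Finset.mul_sum]
    refine Finset.sum_congr rfl fun j _ => ?_
    rw [inner_smul_right, conj_trivial, mul_assoc]

variable [IsContMDiffRiemannianBundle 𝓘(ℝ, E) ∞ E (fun x : M => TangentSpace 𝓘(ℝ, E) x)]

/-- The Lie derivative of the metric along a vertical vector field vanishes on horizontal
fields. -/
lemma mvfderiv_inner_of_vertical {F : M → N}
    (hF : IsRiemannianSubmersion (E := E) (E' := E') F) {x : M}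
    {X Y V : ∀ x : M, TangentSpace 𝓘(ℝ, E) x}
    (hX : MDiffAt (T% X) x) (hY : MDiffAt (T% Y) x) (hV : MDiffAt (T% V) x)
    (hXh : ∀ y, X y ∈ horizontal (E := E) (E' := E') F y)
    (hYh : ∀ y, Y y ∈ horizontal (E := E) (E' := E') F y)
    (hVv : ∀ᶠ y in 𝓝 x, V y ∈ vertical (E := E) (E' := E') F y) :
    mvfderiv 𝓘(ℝ, E) (fun y => ⟪X y, Y y⟫_ℝ) x (V x) =
      ⟪mlieBracket 𝓘(ℝ, E) V X x, Y x⟫_ℝ + ⟪X x, mlieBracket 𝓘(ℝ, E) V Y x⟫_ℝ := by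
  -- `X` and `Y` need not be projectable, so `⟪X, Y⟫` need not come from a function on `N`. It is
  -- still near `x` the sum of `X(f i ∘ F) * Y(f j ∘ F) * (h i j ∘ F)`, built from scalar functions
  -- on `M`, and `V` annihilates everything pulled back from `N`.
  obtain ⟨n, f, h, hf, hh, hmetric⟩ := exists_coordinates (E' := E') (F x)
  have hFx := hF.smooth.contMDiffAt (x := x)
  have hFd : ∀ y, MDifferentiableAt 𝓘(ℝ, E) 𝓘(ℝ, E') F y := fun y =>
    (hF.smooth y).mdifferentiableAt (by simp)
  have hfF : ∀ i, ContMDiffAt 𝓘(ℝ, E) 𝓘(ℝ, ℝ) ∞ (f i ∘ F) x := fun i => (hf i).comp x hFx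
  have hcomp : ∀ᶠ y in 𝓝 x, ∀ i, ∀ v : TangentSpace 𝓘(ℝ, E) y,
      mvfderiv 𝓘(ℝ, E) (f i ∘ F) y v =
        mvfderiv 𝓘(ℝ, E') (f i) (F y) (mfderiv 𝓘(ℝ, E) 𝓘(ℝ, E') F y v) := by
    have : ∀ᶠ y in 𝓝 x, ∀ i, MDifferentiableAt 𝓘(ℝ, E') 𝓘(ℝ, ℝ) (f i) (F y) :=
      hFx.continuousAt.eventually (eventually_all.2 fun i => eventually_mdifferentiableAt (hf i))
    filter_upwards [this] with y hy i v
    exact mvfderiv_comp_apply y (hy i) (hFd y) v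
  have hinner : ∀ᶠ y in 𝓝 x, ∀ v w : TangentSpace 𝓘(ℝ, E) y,
      ⟪mfderiv 𝓘(ℝ, E) 𝓘(ℝ, E') F y v, mfderiv 𝓘(ℝ, E) 𝓘(ℝ, E') F y w⟫_ℝ =
        ∑ i, ∑ j, mvfderiv 𝓘(ℝ, E) (f i ∘ F) y v * mvfderiv 𝓘(ℝ, E) (f j ∘ F) y w *
          h i j (F y) := by
    filter_upwards [hcomp, hFx.continuousAt.eventually hmetric] with y hy hy' v w
    simp only [hy, hy']
  have hVzero : ∀ i, (fun y => mvfderiv 𝓘(ℝ, E) (f i ∘ F) y (V y)) =ᶠ[𝓝 x] fun _ => 0 := by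
    intro i
    filter_upwards [hcomp, hVv] with y hy hy'
    have : mfderiv 𝓘(ℝ, E) 𝓘(ℝ, E') F y (V y) = 0 := hy'
    rw [hy, this, map_zero]
  -- In `[V, U](f i ∘ F)` the term `U(V(f i ∘ F))` disappears because `V(f i ∘ F)` vanishes near
  -- `x`, not only at `x`.
  have hbr : ∀ i, ∀ U : ∀ x : M, TangentSpace 𝓘(ℝ, E) x, MDiffAt (T% U) x →
      mvfderiv 𝓘(ℝ, E) (fun y => mvfderiv 𝓘(ℝ, E) (f i ∘ F) y (U y)) x (V x) =
        mvfderiv 𝓘(ℝ, E) (f i ∘ F) x (mlieBracket 𝓘(ℝ, E) V U x) := by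
    intro i U hU
    have h0 : mvfderiv 𝓘(ℝ, E) (fun y => mvfderiv 𝓘(ℝ, E) (f i ∘ F) y (V y)) x = 0 := by
      have := (hVzero i).mfderiv_eq (I := 𝓘(ℝ, E)) (I' := 𝓘(ℝ, ℝ))
      rw [mfderiv_const] at this
      simp only [mvfderiv] at this ⊢
      rw [this]
      rfl
    rw [(mvfderiv_mlieBracket (hfF i) hV hU).2, h0]
    simp
  have hd : ∀ i, ∀ U : ∀ x : M, TangentSpace 𝓘(ℝ, E) x, MDiffAt (T% U) x →
      MDiffAt (fun y => mvfderiv 𝓘(ℝ, E) (f i ∘ F) y (U y)) x := fun i U hU =>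
    (mvfderiv_mlieBracket (hfF i) hV hU).1
  have hhF : ∀ i j, MDiffAt (h i j ∘ F) x := fun i j => (hh i j).comp x (hFd x)
  have hhV : ∀ i j, mvfderiv 𝓘(ℝ, E) (h i j ∘ F) x (V x) = 0 := by
    intro i j
    have : mfderiv 𝓘(ℝ, E) 𝓘(ℝ, E') F x (V x) = 0 := hVv.self_of_nhds
    rw [mvfderiv_comp_apply x (hh i j) (hFd x), this, map_zero]
  have heq : (fun y => ⟪X y, Y y⟫_ℝ) =ᶠ[𝓝 x] fun y => ∑ i, ∑ j,
      mvfderiv 𝓘(ℝ, E) (f i ∘ F) y (X y) * mvfderiv 𝓘(ℝ, E) (f j ∘ F) y (Y y) *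
        (h i j ∘ F) y := by
    filter_upwards [hinner] with y hy
    rw [← inner_mfderiv_of_mem_horizontal hF (hXh y), hy]
    rfl
  have hdterm : ∀ i j, MDiffAt (fun y => mvfderiv 𝓘(ℝ, E) (f i ∘ F) y (X y) *
      mvfderiv 𝓘(ℝ, E) (f j ∘ F) y (Y y) * (h i j ∘ F) y) x := fun i j =>
    ((hd i X hX).mul (hd j Y hY)).mul (hhF i j)
  have hlhs : mvfderiv 𝓘(ℝ, E) (fun y => ⟪X y, Y y⟫_ℝ) x = mvfderiv 𝓘(ℝ, E) (fun y => ∑ i, ∑ j,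
      mvfderiv 𝓘(ℝ, E) (f i ∘ F) y (X y) * mvfderiv 𝓘(ℝ, E) (f j ∘ F) y (Y y) *
        (h i j ∘ F) y) x := by
    have h1 := heq.mfderiv_eq (I := 𝓘(ℝ, E)) (I' := 𝓘(ℝ, ℝ))
    ext v
    exact DFunLike.congr_fun h1 v
  have hsum : ∀ i ∈ Finset.univ, _ := fun i (_ : i ∈ Finset.univ) =>
    mvfderiv_fun_sum Finset.univ fun j _ => hdterm i j
  rw [hlhs, (mvfderiv_fun_sum Finset.univ fun i hi => (hsum i hi).1).2,
    Finset.sum_congr rfl fun i hi => (hsum i hi).2]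
  -- The brackets with `V` need not be horizontal, but each is paired with a horizontal vector,
  -- which is moved to the first slot.
  rw [real_inner_comm, ← inner_mfderiv_of_mem_horizontal hF (hYh x),
    ← inner_mfderiv_of_mem_horizontal hF (hXh x), real_inner_comm,
    hinner.self_of_nhds, hinner.self_of_nhds]
  simp only [sum_apply, ← Finset.sum_add_distrib]
  refine Finset.sum_congr rfl fun i _ => Finset.sum_congr rfl fun j _ => ?_
  have hXY : MDiffAt (fun y => mvfderiv 𝓘(ℝ, E) (f i ∘ F) y (X y) *
      mvfderiv 𝓘(ℝ, E) (f j ∘ F) y (Y y)) x := (hd i X hX).mul (hd j Y hY)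
  rw [mvfderiv_fun_mul hXY (hhF i j),
    mvfderiv_fun_mul (hd i X hX) (hd j Y hY)]
  simp only [add_apply, smul_apply, smul_eq_mul,
    hbr i X hX, hbr j Y hY, hhV, Function.comp_apply]
  ring

/-- O'Neill's lemma: the vertical part of `∇_X Y` is alternating in horizontal fields. -/
lemma inner_leviCivita_add_swap {F : M → N}
    (hF : IsRiemannianSubmersion (E := E) (E' := E') F) {x : M}
    {X Y : ∀ x : M, TangentSpace 𝓘(ℝ, E) x}
    (hX : MDiffAt (T% X) x) (hY : MDiffAt (T% Y) x)
    (hXh : ∀ y, X y ∈ horizontal (E := E) (E' := E') F y)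
    (hYh : ∀ y, Y y ∈ horizontal (E := E) (E' := E') F y)
    {w : TangentSpace 𝓘(ℝ, E) x} (hw : w ∈ vertical (E := E) (E' := E') F x) :
    ⟪leviCivita E M Y x (X x), w⟫_ℝ + ⟪leviCivita E M X x (Y x), w⟫_ℝ = 0 := by
  obtain ⟨V, hV, rfl, hVv⟩ : ∃ V : ∀ y : M, TangentSpace 𝓘(ℝ, E) y, MDiffAt (T% V) x ∧ V x = w ∧
      ∀ᶠ y in 𝓝 x, V y ∈ vertical (E := E) (E' := E') F y := by
    -- Composing with a chart of `N` makes the target a vector space; as `dφ` is bijective there,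
    -- the kernels remain those of `dF`.
    set φ := extChartAt 𝓘(ℝ, E') (F x) with hφ
    have hFx := hF.smooth.contMDiffAt (x := x)
    have hφF : ContMDiffAt 𝓘(ℝ, E) 𝓘(ℝ, E') ∞ (φ ∘ F) x := contMDiffAt_extChartAt.comp x hFx
    have hd : ∀ y, F y ∈ φ.source → ∀ v : TangentSpace 𝓘(ℝ, E) y,
        mvfderiv 𝓘(ℝ, E) (φ ∘ F) y v = mfderiv 𝓘(ℝ, E') 𝓘(ℝ, E') φ (F y)
          (mfderiv 𝓘(ℝ, E) 𝓘(ℝ, E') F y v) := by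
      intro y hy v
      exact mfderiv_comp_apply y (mdifferentiableAt_extChartAt (by simpa [hφ] using hy))
        ((hF.smooth y).mdifferentiableAt (by simp)) v
    have hinv : ∀ y, F y ∈ φ.source →
        Function.Bijective (mfderiv 𝓘(ℝ, E') 𝓘(ℝ, E') φ (F y)) := fun y hy =>
      (isInvertible_mfderiv_extChartAt (I := 𝓘(ℝ, E')) hy).bijective
    have hxs : F x ∈ φ.source := mem_extChartAt_source (F x)
    obtain ⟨V, hV, hVx, hV0⟩ := exists_extension_mvfderiv_eq_zero hφF (w := w)
      (fun a => by
        obtain ⟨b, hb⟩ := (hinv x hxs).2 a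
        obtain ⟨v, hv⟩ := hF.surjective x b
        exact ⟨v, by rw [hd x hxs, hv]; exact hb⟩)
      (by
        have hw' : mfderiv 𝓘(ℝ, E) 𝓘(ℝ, E') F x w = 0 := hw
        rw [hd x hxs, hw', map_zero]
        rfl)
    refine ⟨V, hV, hVx, ?_⟩
    filter_upwards [hV0, hFx.continuousAt.eventually ((isOpen_extChartAt_source (F x)).mem_nhds hxs)]
      with y hy hys
    rw [hd y hys] at hy
    exact (hinv y hys).1 (hy.trans (map_zero _).symm)
  have hlie := mvfderiv_inner_of_vertical hF hX hY hV hXh hYh hVv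
  have hzero : ∀ U : ∀ x : M, TangentSpace 𝓘(ℝ, E) x,
      (∀ y, U y ∈ horizontal (E := E) (E' := E') F y) →
      mvfderiv 𝓘(ℝ, E) (fun y => ⟪U y, V y⟫_ℝ) x = 0 := by
    intro U hU
    have : (fun y => ⟪U y, V y⟫_ℝ) =ᶠ[𝓝 x] fun _ => 0 := by
      filter_upwards [hVv] with y hy using Submodule.inner_left_of_mem_orthogonal hy (hU y)
    have h1 := this.mfderiv_eq (I := 𝓘(ℝ, E)) (I' := 𝓘(ℝ, ℝ))
    rw [mfderiv_const] at h1
    ext v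
    exact DFunLike.congr_fun h1 v
  -- In the sum of the two Koszul expressions the derivatives of `⟪X, V⟫` and `⟪Y, V⟫` vanish and
  -- the `[X, Y]` terms cancel. What remains is `-2` times the Lie derivative of the metric along
  -- `V` on `X`, `Y`, which is zero by `hlie`.
  have h1 := leviCivita_koszul hX hY hV
  have h2 := leviCivita_koszul hY hX hV
  simp only [koszul, hzero X hXh, hzero Y hYh, zero_apply] at h1 h2
  rw [mlieBracket_swap_apply (V := X) (W := V), mlieBracket_swap_apply (V := Y) (W := V),
    inner_neg_left, inner_neg_left] at h1 h2
  rw [mlieBracket_swap_apply (V := Y) (W := X), inner_neg_left] at h2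
  simp only [real_inner_comm (X _) (Y _)] at h1 h2
  simp only [real_inner_comm (Y _) (X _)] at hlie h1 h2
  rw [real_inner_comm _ (X x)] at hlie
  linarith

end RiemannianSubmersion

/-! ### The slant condition and the integrability criterion. -/

section IntegrabilityCriterion

set_option linter.unusedSectionVars false

variable {E : Type*} [NormedAddCommGroup E] [NormedSpace ℝ E] [FiniteDimensional ℝ E]
  {M : Type*} [TopologicalSpace M] [ChartedSpace E M] [IsManifold 𝓘(ℝ, E) ∞ M]
  [RiemannianBundle (fun x : M => TangentSpace 𝓘(ℝ, E) x)]
  {E' : Type*} [NormedAddCommGroup E'] [NormedSpace ℝ E'] [FiniteDimensional ℝ E']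
  {N : Type*} [TopologicalSpace N] [ChartedSpace E' N] [IsManifold 𝓘(ℝ, E') ∞ N]

/-- If the slant angle is nonzero, a horizontal vector `u` with `J u` horizontal lies in `D₁`. -/
lemma mem_of_mem_horizontal [RiemannianBundle (fun y : N => TangentSpace 𝓘(ℝ, E') y)]
    {J : ∀ x : M, TangentSpace 𝓘(ℝ, E) x →L[ℝ] TangentSpace 𝓘(ℝ, E) x}
    (hJ : IsAlmostHermitian J) {F : M → N} {D₁ : ∀ x : M, Submodule ℝ (TangentSpace 𝓘(ℝ, E) x)}
    {θ : ℝ} (hF : IsVSemiSlantSubmersion (E' := E') F J D₁ θ)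
    (hθ : θ = 0 → ∀ x : M, slantDistribution (E' := E') F D₁ x = ⊥) {x : M}
    {u : TangentSpace 𝓘(ℝ, E) x} (hu : u ∈ horizontal (E := E) (E' := E') F x)
    (hJu : J x u ∈ horizontal (E := E) (E' := E') F x) : u ∈ D₁ x := by
  have hJmem : ∀ v ∈ D₁ x, J x v ∈ D₁ x := fun v hv => by
    rw [← hF.map_eq x]
    exact Submodule.mem_map_of_mem hv
  obtain ⟨a, ha, b, hb, rfl⟩ := (D₁ x).exists_add_mem_mem_orthogonal u
  have hbD : b ∈ slantDistribution (E' := E') F D₁ x :=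
    ⟨hb, (Submodule.add_mem_iff_right _ (hF.le_horizontal x ha)).1 hu⟩
  have hJbD : J x b ∈ slantDistribution (E' := E') F D₁ x := by
    refine ⟨(Submodule.mem_orthogonal _ _).2 fun d hd => ?_, ?_⟩
    -- Since `D₁ = J D₁` and `J` is orthogonal, `J` also preserves the orthogonal complement of
    -- `D₁`.
    · rw [← hF.map_eq x] at hd
      obtain ⟨c, hc, rfl⟩ := hd
      exact (hJ.inner_map x c b).trans (Submodule.inner_right_of_mem_orthogonal hc hb)
    · rw [map_add] at hJu
      exact (Submodule.add_mem_iff_right _ (hF.le_horizontal x (hJmem a ha))).1 hJu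
  suffices b = 0 by rwa [this, add_zero]
  by_contra hb0
  have hJb0 : J x b ≠ 0 := fun h => hb0 (by simpa [h] using hJ.sq x b)
  -- `J b` lies in `D₂`, so it is its own projection and the angle is `arccos 1 = 0`; then `D₂ = 0`,
  -- contradicting `b ≠ 0`.
  have h := hF.angle_eq x b hbD hb0
  rw [angleWithSubspace, Submodule.starProjection_eq_self_iff.2 hJbD,
    div_self (norm_ne_zero_iff.2 hJb0), Real.arccos_one] at h
  rw [hθ h.symm x] at hbD
  exact hb0 hbD

variable [IsContMDiffRiemannianBundle 𝓘(ℝ, E) ∞ E (fun x : M => TangentSpace 𝓘(ℝ, E) x)]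

/-- On horizontal fields O'Neill's tensor is the vertical part of `∇_X Y`. -/
lemma oneillA_eq_zero_iff {F : M → N} {X Y : ∀ x : M, TangentSpace 𝓘(ℝ, E) x}
    (hX : ∀ y, X y ∈ horizontal (E := E) (E' := E') F y)
    (hY : ∀ y, Y y ∈ horizontal (E := E) (E' := E') F y) (x : M) :
    oneillA (E' := E') F X Y x = 0 ↔
      leviCivita E M Y x (X x) ∈ horizontal (E := E) (E' := E') F x := by
  have hhX : hPart (E' := E') F X = X := by
    ext y
    exact Submodule.starProjection_eq_self_iff.2 (hX y)
  have hhY : hPart (E' := E') F Y = Y := by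
    ext y
    exact Submodule.starProjection_eq_self_iff.2 (hY y)
  have hvY : vPart (E' := E') F Y = 0 := by
    ext y
    exact (Submodule.starProjection_apply_eq_zero_iff _).2 (hY y)
  have h0 : leviCivita E M (0 : ∀ x : M, TangentSpace 𝓘(ℝ, E) x) x = 0 := by
    simp
  rw [oneillA, Pi.add_apply, hhX, hhY, hvY, hPart, h0, zero_apply, map_zero, zero_add]
  exact Submodule.starProjection_apply_eq_zero_iff _

/-- `∇_X Y - ∇_Y X = [X, Y]` for the Levi-Civita connection. -/
lemma leviCivita_sub_swap {X Y : ∀ x : M, TangentSpace 𝓘(ℝ, E) x} {x : M}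
    (hX : MDiffAt (T% X) x) (hY : MDiffAt (T% Y) x) :
    leviCivita E M Y x (X x) - leviCivita E M X x (Y x) = mlieBracket 𝓘(ℝ, E) X Y x :=
  (CovariantDerivative.torsion_eq_zero_iff _).1 leviCivita_torsion hX hY

/-- Allows the vanishing of `A` to be applied to the pair `X`, `JY` as well. -/
lemma isSection_map_of_isAlmostHermitian
    {J : ∀ x : M, TangentSpace 𝓘(ℝ, E) x →L[ℝ] TangentSpace 𝓘(ℝ, E) x}
    (hJ : IsAlmostHermitian J) {D : ∀ x : M, Submodule ℝ (TangentSpace 𝓘(ℝ, E) x)}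
    (hD : ∀ x, ∀ v ∈ D x, J x v ∈ D x)
    {Y : ∀ x : M, TangentSpace 𝓘(ℝ, E) x} (hY : IsSection D Y) :
    IsSection D fun y => J y (Y y) :=
  ⟨fun x => (hJ.smooth x).clm_bundle_apply (hY.1 x), fun x => hD x _ (hY.2 x)⟩

end IntegrabilityCriterion

theorem lemma3p6
    {E : Type*} [NormedAddCommGroup E] [NormedSpace ℝ E] [FiniteDimensional ℝ E]
    {M : Type*} [TopologicalSpace M] [T2Space M] [SecondCountableTopology M]
    [ChartedSpace E M] [IsManifold 𝓘(ℝ, E) ∞ M]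
    [RiemannianBundle (fun x : M => TangentSpace 𝓘(ℝ, E) x)]
    [IsContMDiffRiemannianBundle 𝓘(ℝ, E) ∞ E (fun x : M => TangentSpace 𝓘(ℝ, E) x)]
    {E' : Type*} [NormedAddCommGroup E'] [NormedSpace ℝ E'] [FiniteDimensional ℝ E']
    {N : Type*} [TopologicalSpace N] [T2Space N] [SecondCountableTopology N]
    [ChartedSpace E' N] [IsManifold 𝓘(ℝ, E') ∞ N]
    [RiemannianBundle (fun y : N => TangentSpace 𝓘(ℝ, E') y)]
    [IsContMDiffRiemannianBundle 𝓘(ℝ, E') ∞ E' (fun y : N => TangentSpace 𝓘(ℝ, E') y)]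
    (J : ∀ x : M, TangentSpace 𝓘(ℝ, E) x →L[ℝ] TangentSpace 𝓘(ℝ, E) x)
    (hJ : IsKahler J)
    (F : M → N) (D₁ : ∀ x : M, Submodule ℝ (TangentSpace 𝓘(ℝ, E) x)) (θ : ℝ)
    (hF : IsVSemiSlantSubmersion (E' := E') F J D₁ θ)
    (hθ : θ = 0 → ∀ x : M, slantDistribution (E' := E') F D₁ x = ⊥) :
    IsIntegrableDistribution D₁ ↔
      ∀ X Y : ∀ x : M, TangentSpace 𝓘(ℝ, E) x, IsSection D₁ X → IsSection D₁ Y →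
        ∀ x : M, oneillA (E' := E') F X Y x = 0 := by
  have hH : ∀ X : ∀ x : M, TangentSpace 𝓘(ℝ, E) x, IsSection D₁ X →
      ∀ y, X y ∈ horizontal (E := E) (E' := E') F y :=
    fun X hX y => hF.le_horizontal y (hX.2 y)
  have hd : ∀ X : ∀ x : M, TangentSpace 𝓘(ℝ, E) x, IsSection D₁ X → ∀ x, MDiffAt (T% X) x :=
    fun X hX x => (hX.1 x).mdifferentiableAt (by simp)
  constructor
  · intro hint X Y hX hY x
    rw [oneillA_eq_zero_iff (hH X hX) (hH Y hY)]
    refine (Submodule.mem_orthogonal' _ _).2 fun w hw => ?_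
    have h1 := inner_leviCivita_add_swap hF.toIsRiemannianSubmersion (hd X hX x) (hd Y hY x)
      (hH X hX) (hH Y hY) hw
    have h2 : ⟪mlieBracket 𝓘(ℝ, E) X Y x, w⟫_ℝ = 0 :=
      Submodule.inner_left_of_mem_orthogonal hw
        (hF.le_horizontal x ((hint X Y hX hY).2 x))
    -- The vertical components of `∇_X Y` and `∇_Y X` have sum zero by `h1` and difference zero by
    -- `h2`, so both vanish.
    rw [← leviCivita_sub_swap (hd X hX x) (hd Y hY x), inner_sub_left] at h2
    linarith
  · intro hA
    have hmem : ∀ X Y : ∀ x : M, TangentSpace 𝓘(ℝ, E) x, IsSection D₁ X → IsSection D₁ Y →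
        ∀ x, leviCivita E M Y x (X x) ∈ D₁ x := by
      intro X Y hX hY x
      have hJY := isSection_map_of_isAlmostHermitian hJ.toIsAlmostHermitian (fun x v hv => by
        rw [← hF.map_eq x]
        exact Submodule.mem_map_of_mem hv) hY
      refine mem_of_mem_horizontal hJ.toIsAlmostHermitian hF hθ
        ((oneillA_eq_zero_iff (hH X hX) (hH Y hY) x).1 (hA X Y hX hY x)) ?_
      -- `J ∇_X Y = ∇_X (JY)` is horizontal because `A` vanishes on `X`, `JY`.
      rw [← hJ.parallel X Y hX.1 hY.1 x]
      exact (oneillA_eq_zero_iff (hH X hX) (hH _ hJY) x).1 (hA X _ hX hJY x)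
    intro X Y hX hY
    have : IsManifold 𝓘(ℝ, E) (minSmoothness ℝ 2) M := by
      rw [minSmoothness_of_isRCLikeNormedField]
      infer_instance
    -- Smoothness of the bracket needs one more order of regularity; as `∞ + 1 = ∞`, nothing is
    -- lost.
    have : IsManifold 𝓘(ℝ, E) (((⊤ : ℕ∞) : ℕ∞ω) + 1) M := inferInstanceAs (IsManifold 𝓘(ℝ, E) ∞ M)
    refine ⟨fun x => (hX.1 x).mlieBracket_vectorField (hY.1 x) (m := ⊤) (n := ⊤) (by simp),
      fun x => ?_⟩
    rw [← leviCivita_sub_swap (hd X hX x) (hd Y hY x)]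
    exact sub_mem (hmem X Y hX hY x) (hmem Y X hY hX x)
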